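/- For a real number $x$ let $\|x\|$ be its distance to the nearest integer, and for an algebraic number $\theta$ let $h(\theta)=\prod_{v}\max\{1,|\theta|_v\}^{d_v/d}$ be its absolute multiplicative Weil height, where $v$ runs over the places of a number field $K\ni\theta$, $d=[K:\mathbb{Q}]$, $d_v=[K_v:\mathbb{Q}_v]$, and $|\cdot|_v$ extends the usual or a standard $p$-adic absolute value on $\mathbb{Q}$ (the value does not depend on $K$). Let $t\ge 1$, let $1,\theta_1,\dots,\theta_t$ be $\mathbb{Q}$-linearly independent real algebraic numbers, let $d_j=[\mathbb{Q}(\theta_j):\mathbb{Q}]$ and $e=[\mathbb{Q}(\theta_1,\dots,\theta_t):\mathbb{Q}]$, and put $$\mathcal{C}_1=\Bigl((t+1)\max_{1\le j\le t}h(\theta_j)^{d_j}\Bigr)^{e-1}\prod_{j=1}^t\bigl(2h(\theta_j)\bigr)^{e d_j}.$$ Let $0<\varepsilon\le 1$. Then for every $(a_1,\dots,a_t)\in\mathbb{R}^t$ there exists $q\in\mathbb{Z}\setminus\{0\}$ such that $$\|q\theta_j-a_j\|\le\varepsilon\quad(1\le j\le t)\qquad\text{and}\qquad |q|\le 2^{-et}\bigl((t+1)!\bigr)^{2e}\,\mathcal{C}_1\,\varepsilon^{-e+1}.$$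 Moreover, this $q$ also satisfies the following: if $H$ is a real number with $h(\theta_j)\le H$ for all $1\le j\le t$ and $\ell$ is an integer with $\max\{e,d_1,\dots,d_t\}\le\ell$, then $$|q|\le 2^{\ell t(\ell-1)}(t+1)^{3\ell-1}(t!)^{2\ell}H^{\ell^2(t+1)-\ell}\,\varepsilon^{-\ell+1}.$$ -/

import Mathlib

namespace EffectiveKronecker

/-- The distance from a real number to the nearest integer. -/
noncomputable def distInt (x : ℝ) : ℝ := |x - round x|

/-- The degree over `ℚ` of the field generated by the numbers `θ_j`. -/
noncomputable def fieldDegree {t : ℕ} (θ : Fin t → ℝ) : ℕ :=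
  Module.finrank ℚ (IntermediateField.adjoin ℚ (Set.range θ))

/-- The degree of an algebraic number. -/
noncomputable def algDegree (x : ℝ) : ℕ := (minpoly ℚ x).natDegree

/-- The absolute multiplicative Weil height
`h(x) = ∏_v max(1, |x|_v) ^ (d_v / d)` of an algebraic number `x`, computed in `ℚ(x)`. -/
noncomputable def weilHeight (x : ℝ) : ℝ := NumberField.absMulHeight₁ x

/-- The constant
`C₁ = ((t + 1) max_j h(θ_j) ^ d_j) ^ (e - 1) * ∏_j (2 h(θ_j)) ^ (e d_j)`. For algebraic `θ_j`
one has `e ≥ 1`, so the subtraction of natural numbers is the usual one; the maximum is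
over a finite index set, which is nonempty when `t ≥ 1`. -/
noncomputable def C₁ {t : ℕ} (θ : Fin t → ℝ) : ℝ :=
  (((t : ℝ) + 1) * ⨆ j, weilHeight (θ j) ^ algDegree (θ j)) ^ (fieldDegree θ - 1) *
    ∏ j, (2 * weilHeight (θ j)) ^ (fieldDegree θ * algDegree (θ j))

end EffectiveKronecker

/-! Kronecker's theorem is made effective by duality. Put `α = m₀ + ∑ m_j θ_j` and map `(m₀, m)` in
`ℤ^(t+1)` to `(Q α, ε m)` in Euclidean space. If no nonzero image is shorter than `2 ^ t`, then
`exists_inner_eq_character` realises every character of `ℤ^(t+1)` as the inner product, mod 1, with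
a vector `y` of norm at most 1. For the character built from `a` and a centre `b`, the first basis
vector makes `q = b + Q y₀` an integer, and the others put `q θ_j - a_j` within `ε` of one. Taking
`b = 2 * Q` forces `Q ≤ q ≤ 3 * Q`, so `q ≠ 0`.

The admissible `Q` comes from a Liouville inequality, `one_le_abs_linearForm_mul`: clearing
denominators turns `α ≠ 0` into an algebraic integer, whose norm is at least 1 in absolute value, so
`α` is not small when its conjugates are bounded. It remains to compare `3 * Q` with the stated
constants. -/

open scoped InnerProductSpace

/-! ### Characters of discrete groups in Euclidean space -/

/-- A discrete additive subgroup of a finite-dimensional normed space, given as the range of a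
homomorphism, has a shortest nonzero element. -/
lemma exists_shortest_of_range {M V : Type*} [AddCommGroup M] [NormedAddCommGroup V]
    [NormedSpace ℝ V] [FiniteDimensional ℝ V] (f : M →+ V) {c : ℝ} (hc : 0 < c)
    (hf : ∀ m, f m ≠ 0 → c ≤ ‖f m‖) (hne : ∃ m, f m ≠ 0) :
    ∃ m, f m ≠ 0 ∧ ∀ m', f m' ≠ 0 → ‖f m‖ ≤ ‖f m'‖ := by
  obtain ⟨m₁, hm₁⟩ := hne
  have hdisc : DiscreteTopology f.range := by
    refine DiscreteTopology.of_forall_le_norm (E := f.range) hc ?_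
    rintro ⟨_, m, rfl⟩ hm
    exact hf m (fun h => hm (Subtype.ext h))
  have hfin : (Metric.closedBall (0 : V) ‖f m₁‖ ∩ (f.range : Set V)).Finite :=
    Metric.finite_isBounded_inter_isClosed ⟨hdisc⟩ Metric.isBounded_closedBall
      AddSubgroup.isClosed_of_discrete
  have hS : ((Metric.closedBall (0 : V) ‖f m₁‖ ∩ (f.range : Set V)) \ {0}).Finite :=
    hfin.subset Set.sdiff_subset
  obtain ⟨w, ⟨⟨hwb, m, rfl⟩, hw0⟩, hmin⟩ := hS.exists_minimalFor (fun v => ‖v‖) _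
    ⟨f m₁, ⟨by simp, m₁, rfl⟩, by simpa using hm₁⟩
  refine ⟨m, by simpa using hw0, fun m' hm' => ?_⟩
  by_cases h : ‖f m'‖ ≤ ‖f m₁‖
  · have := @hmin (f m') ⟨⟨by simpa using h, m', rfl⟩, by simpa using hm'⟩
    rcases le_total ‖f m‖ ‖f m'‖ with h1 | h1
    · exact h1
    · exact this h1
  · exact le_trans (by simpa using hwb) (not_le.1 h).le

lemma UnitAddCircle.coe_eq_coe_iff (x y : ℝ) :
    (x : UnitAddCircle) = y ↔ ∃ k : ℤ, x - y = k := by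
  rw [← sub_eq_zero, ← AddCircle.coe_sub, AddCircle.coe_eq_zero_iff]
  simp [eq_comm]

lemma UnitAddCircle.exists_abs_le_half (x : UnitAddCircle) :
    ∃ s : ℝ, |s| ≤ 1 / 2 ∧ (s : UnitAddCircle) = x := by
  obtain ⟨r, rfl⟩ := QuotientAddGroup.mk_surjective x
  exact ⟨r - round r, abs_sub_round r,
    (UnitAddCircle.coe_eq_coe_iff _ _).2 ⟨-round r, by push_cast; ring⟩⟩

/-- **Inhomogeneous transference.** If the nonzero vectors of an additive group of vectors in a
Euclidean space of dimension `k` are not short, then every character of the group is given by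
the inner product with a short vector. -/
theorem exists_inner_eq_character {M V : Type*} [AddCommGroup M] [NormedAddCommGroup V]
    [InnerProductSpace ℝ V] [FiniteDimensional ℝ V] (k : ℕ) (W : Submodule ℝ V)
    (hW : Module.finrank ℝ W ≤ k) (f : M →+ V) (hfW : ∀ m, f m ∈ W) (φ : M →+ UnitAddCircle)
    (hker : ∀ m, f m = 0 → φ m = 0) {c : ℝ} (hc : 0 < c)
    (hf : ∀ m, f m ≠ 0 → c ≤ ‖f m‖ ^ 2) :
    ∃ y ∈ W, ‖y‖ ^ 2 * c ≤ 4 ^ k / 4 ∧ ∀ m, ((⟪y, f m⟫_ℝ : ℝ) : UnitAddCircle) = φ m := by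
  induction k generalizing W f φ c with
  | zero =>
    refine ⟨0, W.zero_mem, by norm_num, fun m => ?_⟩
    have hW0 : W = ⊥ := Submodule.finrank_eq_zero.1 (Nat.le_zero.1 hW)
    have : f m = 0 := by simpa [hW0] using hfW m
    rw [hker m this, inner_zero_left, AddCircle.coe_zero]
  | succ k ih =>
    by_cases hne : ∃ m, f m ≠ 0
    swap
    · push Not at hne
      refine ⟨0, W.zero_mem, by simp; positivity, fun m => ?_⟩
      rw [hker m (hne m), inner_zero_left, AddCircle.coe_zero]
    obtain ⟨m₀, hm₀, hmin⟩ := exists_shortest_of_range f (Real.sqrt_pos.2 hc)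
      (fun m hm => Real.sqrt_le_iff.2 ⟨norm_nonneg _, hf m hm⟩) hne
    set w := f m₀ with hw
    have hw2 : 0 < ‖w‖ ^ 2 := by positivity
    have hww : ⟪w, w⟫_ℝ = ‖w‖ ^ 2 := real_inner_self_eq_norm_sq w
    obtain ⟨s, hs, hsφ⟩ := UnitAddCircle.exists_abs_le_half (φ m₀)
    let r : V → ℝ := fun v => ⟪w, v⟫_ℝ / ‖w‖ ^ 2
    let P : V →ₗ[ℝ] V :=
      LinearMap.id - ((‖w‖ ^ 2)⁻¹ • innerₛₗ ℝ w).smulRight w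
    have hP : ∀ v, P v = v - r v • w := fun v => by
      simp [P, r, div_eq_inv_mul]
    have hPw : ∀ v, ⟪w, P v⟫_ℝ = 0 := fun v => by
      rw [hP, inner_sub_right, inner_smul_right, hww, div_mul_cancel₀ _ hw2.ne', sub_self]
    -- Subtracting the nearest multiple of `m₀` leaves a component along `w` of length at most `‖w‖
    -- / 2`.
    have hred : ∀ m, ‖f (m - round (r (f m)) • m₀)‖ ^ 2 ≤ ‖P (f m)‖ ^ 2 + ‖w‖ ^ 2 / 4 := fun m => by
      have h1 : f (m - round (r (f m)) • m₀) = P (f m) + (r (f m) - round (r (f m))) • w := by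
        rw [hP, map_sub, map_zsmul, ← hw, sub_smul, Int.cast_smul_eq_zsmul]; abel
      have h2 : ‖f (m - round (r (f m)) • m₀)‖ ^ 2
          = ‖P (f m)‖ ^ 2 + (r (f m) - round (r (f m))) ^ 2 * ‖w‖ ^ 2 := by
        rw [h1, norm_add_sq_real, inner_smul_right, real_inner_comm, hPw, norm_smul, mul_pow,
          Real.norm_eq_abs, sq_abs]
        ring
      have h3 : (r (f m) - round (r (f m))) ^ 2 ≤ 1 / 4 := by
        have := abs_sub_round (r (f m))
        rw [← sq_abs]
        nlinarith [abs_nonneg (r (f m) - round (r (f m)))]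
      nlinarith
    have hPred : ∀ m (n : ℤ), P (f (m - n • m₀)) = P (f m) := fun m n => by
      have : P w = 0 := by
        rw [hP]
        simp only [r]
        rw [hww, div_self hw2.ne', one_smul, sub_self]
      rw [map_sub, map_zsmul, map_sub, map_zsmul, ← hw, this, smul_zero, sub_zero]
    let y₁ : V := (s / ‖w‖ ^ 2) • w
    have hy₁w : ⟪y₁, w⟫_ℝ = s := by
      simp only [y₁]
      rw [real_inner_smul_left, hww, div_mul_cancel₀ _ hw2.ne']
    let ψ : M →+ UnitAddCircle :=
      φ - (QuotientAddGroup.mk' (AddSubgroup.zmultiples (1 : ℝ))).comp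
        ((innerₛₗ ℝ y₁).toAddMonoidHom.comp f)
    have hψ : ∀ m, ψ m = φ m - ((⟪y₁, f m⟫_ℝ : ℝ) : UnitAddCircle) := fun m => rfl
    -- If the projection vanishes, the reduced vector is shorter than the shortest nonzero vector
    -- `w`, hence zero. So `f m` is a multiple of `w`, where `y₁` already gives the right character.
    have hψker : ∀ m, P (f m) = 0 → ψ m = 0 := fun m hm => by
      have h0 : f (m - round (r (f m)) • m₀) = 0 := by
        by_contra hne0
        have h1 := hmin _ hne0
        have h2 := hred m
        rw [hm, norm_zero] at h2
        have h3 : ‖w‖ ^ 2 ≤ ‖f (m - round (r (f m)) • m₀)‖ ^ 2 := by gcongr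
        linarith [hw2]
      have h1 := hker _ h0
      rw [map_sub, map_zsmul, sub_eq_zero] at h0 h1
      generalize round (r (f m)) = n at h0 h1
      have h2 : ⟪y₁, n • w⟫_ℝ = n * s := by
        rw [← Int.cast_smul_eq_zsmul ℝ, inner_smul_right, hy₁w]
      rw [hψ, h1, h0, ← hsφ, ← hw, h2, ← AddCircle.coe_zsmul, zsmul_eq_mul, sub_self]
    let W' : Submodule ℝ V := W ⊓ (ℝ ∙ w)ᗮ
    have hwW : w ∈ W := hfW m₀
    have hW' : Module.finrank ℝ W' ≤ k := by
      have hlt : W' < W := by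
        refine lt_of_le_of_ne inf_le_left fun h => ?_
        have hmem : w ∈ W' := h ▸ hwW
        have := Submodule.mem_orthogonal_singleton_iff_inner_right.1 hmem.2
        rw [hww] at this
        exact hw2.ne' this
      have := Submodule.finrank_lt_finrank_of_lt hlt
      omega
    -- A nonzero projection has a nonzero reduced lift, so its squared norm is at least `‖w‖ ^ 2 -
    -- ‖w‖ ^ 2 / 4 ≥ 3 / 4 * c`.
    obtain ⟨y₂, hy₂W, hy₂, hy₂φ⟩ := ih W' hW' (P.toAddMonoidHom.comp f)
      (fun m => ⟨by
        change P (f m) ∈ W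
        rw [hP]
        exact W.sub_mem (hfW m) (W.smul_mem _ hwW),
        Submodule.mem_orthogonal_singleton_iff_inner_right.2 (hPw _)⟩) ψ hψker
      (c := 3 / 4 * c) (by positivity) (fun m hm => by
        change P (f m) ≠ 0 at hm
        change _ ≤ ‖P (f m)‖ ^ 2
        have hne0 : f (m - round (r (f m)) • m₀) ≠ 0 := fun h0 => by
          apply hm
          rw [← hPred m (round (r (f m))), h0, map_zero]
        have h1 := hmin _ hne0
        have h2 := hred m
        have h3 : ‖w‖ ^ 2 ≤ ‖f (m - round (r (f m)) • m₀)‖ ^ 2 := by gcongr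
        have h4 := hf m₀ hm₀
        linarith)
    have hy₂w : ⟪w, y₂⟫_ℝ = 0 := Submodule.mem_orthogonal_singleton_iff_inner_right.1 hy₂W.2
    refine ⟨y₁ + y₂, W.add_mem (W.smul_mem _ hwW) hy₂W.1, ?_, fun m => ?_⟩
    · have h1 : ‖y₁ + y₂‖ ^ 2 = s ^ 2 / ‖w‖ ^ 2 + ‖y₂‖ ^ 2 := by
        simp only [y₁]
        rw [norm_add_sq_real, real_inner_smul_left, hy₂w, norm_smul, mul_pow, Real.norm_eq_abs,
          sq_abs]
        field_simp
        ring
      have h2 : s ^ 2 ≤ 1 / 4 := by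
        rw [← sq_abs]
        nlinarith [abs_nonneg s]
      have h3 : s ^ 2 / ‖w‖ ^ 2 * c ≤ 1 / 4 := by
        rw [div_mul_eq_mul_div, div_le_iff₀ hw2]
        have := hf m₀ hm₀
        nlinarith [sq_nonneg s]
      -- The two orthogonal parts contribute at most `1 / 4 + 4 ^ k / 3 ≤ 4 ^ k`.
      have h4 : (1 : ℝ) ≤ 4 ^ k := one_le_pow₀ (by norm_num)
      rw [h1, pow_succ (4 : ℝ) k]
      nlinarith
    · have h1 : ⟪y₂, P (f m)⟫_ℝ = ⟪y₂, f m⟫_ℝ := by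
        rw [hP, inner_sub_right, inner_smul_right, real_inner_comm w y₂, hy₂w, mul_zero, sub_zero]
      have h2 : ((⟪y₂, P (f m)⟫_ℝ : ℝ) : UnitAddCircle) = ψ m := hy₂φ m
      rw [inner_add_left, AddCircle.coe_add, ← h1, h2, hψ]
      abel

/-! ### Heights and the Liouville inequality -/

section Heights

open NumberField Height IntermediateField

lemma NumberField.infinitePlace_apply_le_mulHeight₁ {K : Type*} [Field K] [NumberField K] (x : K)
    (v : InfinitePlace K) : v x ≤ mulHeight₁ x := by
  rw [NumberField.mulHeight₁_eq]
  have h1 : (1 : ℝ) ≤ ∏ᶠ w : FinitePlace K, max (w x) 1 := one_le_finprod fun _ ↦ le_max_right ..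
  have h2 : v x ≤ max (v x) 1 ^ v.mult :=
    (le_max_left _ _).trans (le_self_pow₀ (le_max_right _ _) InfinitePlace.mult_ne_zero)
  have h3 : max (v x) 1 ^ v.mult ≤ ∏ w : InfinitePlace K, max (w x) 1 ^ w.mult := by
    classical
    rw [← Finset.mul_prod_erase _ _ (Finset.mem_univ v)]
    exact le_mul_of_one_le_right (by positivity)
      (Finset.one_le_prod fun w _ => one_le_pow₀ (le_max_right _ _))
  have h4 := h2.trans h3
  calc v x ≤ ∏ w : InfinitePlace K, max (w x) 1 ^ w.mult := h4
    _ ≤ _ := le_mul_of_one_le_right ((apply_nonneg v x).trans h4) h1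

namespace EffectiveKronecker

variable {x : ℝ}

/-- The power undoes the normalisation: the height relative to `ℚ(x)` is what bounds both the
denominator and the conjugates. -/
lemma weilHeight_pow_algDegree (hx : IsAlgebraic ℚ x) [NumberField ℚ⟮x⟯] :
    weilHeight x ^ algDegree x = mulHeight₁ (AdjoinSimple.gen ℚ x) := by
  have hd : algDegree x = Module.finrank ℚ ℚ⟮x⟯ := (adjoin.finrank hx.isIntegral).symm
  have hne : Module.finrank ℚ ℚ⟮x⟯ ≠ 0 := Module.finrank_pos.ne'
  rw [weilHeight, absMulHeight₁, dif_pos hx.isIntegral, hd,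
    Real.rpow_inv_natCast_pow (mulHeight₁_nonneg _) hne]

lemma numberField_adjoin_simple (hx : IsAlgebraic ℚ x) : NumberField ℚ⟮x⟯ :=
  have : FiniteDimensional ℚ ℚ⟮x⟯ := adjoin.finiteDimensional hx.isIntegral
  {}

lemma one_le_weilHeight (hx : IsAlgebraic ℚ x) : 1 ≤ weilHeight x := by
  rw [weilHeight, absMulHeight₁, dif_pos hx.isIntegral]
  have := numberField_adjoin_simple hx
  exact Real.one_le_rpow (one_le_mulHeight₁ _) (by positivity)

lemma exists_denominator_le (hx : IsAlgebraic ℚ x) :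
    ∃ n : ℕ, n ≠ 0 ∧ (n : ℝ) ≤ weilHeight x ^ algDegree x ∧ IsIntegral ℤ ((n : ℝ) * x) := by
  have := numberField_adjoin_simple hx
  obtain ⟨n, hn, hle, hint⟩ := exists_nat_le_mulHeight₁ (AdjoinSimple.gen ℚ x)
  refine ⟨n, hn, by rwa [weilHeight_pow_algDegree hx], ?_⟩
  have := hint.map (algebraMap ℚ⟮x⟯ ℝ).toIntAlgHom
  simpa using this

lemma norm_embedding_le {K : IntermediateField ℚ ℝ} (y : K) (hy : IsAlgebraic ℚ (y : ℝ))
    (σ : K →ₐ[ℚ] ℂ) : ‖σ y‖ ≤ weilHeight (y : ℝ) ^ algDegree (y : ℝ) := by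
  have := numberField_adjoin_simple hy
  have hle : ℚ⟮(y : ℝ)⟯ ≤ K := adjoin_simple_le_iff.2 y.2
  have := infinitePlace_apply_le_mulHeight₁ (AdjoinSimple.gen ℚ (y : ℝ))
    (InfinitePlace.mk (σ.comp (inclusion hle)).toRingHom)
  rw [weilHeight_pow_algDegree hy]
  exact this

lemma two_le_algDegree (hx : IsAlgebraic ℚ x) (hirr : ∀ r : ℚ, (r : ℝ) ≠ x) : 2 ≤ algDegree x := by
  rw [algDegree, minpoly.two_le_natDegree_iff hx.isIntegral]
  rintro ⟨r, hr⟩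
  exact hirr r (by simpa using hr)

section Liouville

variable {t : ℕ} {θ : Fin t → ℝ}

/-- A Liouville inequality for linear forms in algebraic numbers. -/
theorem one_le_abs_linearForm_mul (hθ : ∀ j, IsAlgebraic ℚ (θ j)) (m₀ : ℤ) (m : Fin t → ℤ)
    (hm : m ≠ 0) {G : ℝ} (hG : ∀ j, weilHeight (θ j) ^ algDegree (θ j) ≤ G) (hG1 : 1 ≤ G)
    (hne : (m₀ : ℝ) + ∑ j, m j * θ j ≠ 0) (hle : |(m₀ : ℝ) + ∑ j, m j * θ j| ≤ 1) :
    1 ≤ |(m₀ : ℝ) + ∑ j, m j * θ j| * (3 * (∑ j, |(m j : ℝ)|) * G) ^ (fieldDegree θ - 1) *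
      ∏ j, weilHeight (θ j) ^ (fieldDegree θ * algDegree (θ j)) := by
  set K := IntermediateField.adjoin ℚ (Set.range θ) with hK
  have : FiniteDimensional ℚ K := by
    apply IntermediateField.finiteDimensional_adjoin
    rintro _ ⟨j, rfl⟩
    exact (hθ j).isIntegral
  have : NumberField K := {}
  set e := fieldDegree θ with he
  have hcard : Fintype.card (K →ₐ[ℚ] ℂ) = e := AlgHom.card ℚ K ℂ
  let ϑ : Fin t → K := fun j => ⟨θ j, IntermediateField.subset_adjoin _ _ ⟨j, rfl⟩⟩
  choose n hn0 hnle hnint using fun j => exists_denominator_le (hθ j)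
  let N : ℕ := ∏ j, n j
  let α : K := m₀ + ∑ j, m j * ϑ j
  have hα : (α : ℝ) = m₀ + ∑ j, m j * θ j := by
    simp [α, ϑ]
  have hα0 : α ≠ 0 := fun h => hne (by rw [← hα, h]; rfl)
  have hN0 : N ≠ 0 := Finset.prod_ne_zero_iff.2 fun j _ => hn0 j
  have hint : IsIntegral ℤ ((N : K) * α) := by
    have hj : ∀ j, IsIntegral ℤ ((N : K) * ϑ j) := fun j => by
      have h1 : IsIntegral ℤ ((n j : K) * ϑ j) := by
        refine (isIntegral_algHom_iff (algebraMap K ℝ).toIntAlgHom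
          (algebraMap K ℝ).injective).1 ?_
        simpa [ϑ] using hnint j
      have h2 : (N : K) = (∏ i ∈ Finset.univ.erase j, (n i : K)) * n j := by
        simp only [N]
        push_cast
        exact (Finset.prod_erase_mul _ _ (Finset.mem_univ j)).symm
      rw [h2, mul_assoc]
      refine IsIntegral.mul (IsIntegral.prod _ fun i _ => isIntegral_natCast _) h1
    have : (N : K) * α = N * m₀ + ∑ j, m j * (N * ϑ j) := by
      simp only [α]
      rw [mul_add, Finset.mul_sum]
      congr 1
      exact Finset.sum_congr rfl fun j _ => by ring
    rw [this]
    exact ((isIntegral_natCast _).mul (isIntegral_intCast _)).add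
      (IsIntegral.sum _ fun j _ => (isIntegral_intCast _).mul (hj j))
  classical
  have hnorm : (1 : ℝ) ≤ ∏ σ : K →ₐ[ℚ] ℂ, ‖σ ((N : K) * α)‖ := by
    obtain ⟨z, hz⟩ := IsIntegrallyClosed.isIntegral_iff.1 (Algebra.isIntegral_norm ℚ hint)
    have h0 : Algebra.norm ℚ ((N : K) * α) ≠ 0 :=
      Algebra.norm_ne_zero_iff.2 (mul_ne_zero (Nat.cast_ne_zero.2 hN0) hα0)
    have h1 := congrArg (‖·‖) (Algebra.norm_eq_prod_embeddings ℚ ℂ ((N : K) * α))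
    simp only [norm_prod] at h1
    rw [← h1, ← hz]
    have hz0 : z ≠ 0 := by
      rintro rfl
      exact h0 (by rw [← hz]; simp)
    have : (1 : ℝ) ≤ |(z : ℝ)| := by exact_mod_cast Int.one_le_abs hz0
    simpa using this
  let σ₀ : K →ₐ[ℚ] ℂ := (Complex.ofRealAm.restrictScalars ℚ).comp K.val
  have hσ₀ : ∀ y : K, σ₀ y = ((y : ℝ) : ℂ) := fun y => rfl
  set A := ∑ j, |(m j : ℝ)| with hA
  have hA1 : 1 ≤ A := by
    obtain ⟨j, hj⟩ := Function.ne_iff.1 hm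
    have h1 : (1 : ℝ) ≤ |(m j : ℝ)| := by exact_mod_cast Int.one_le_abs hj
    exact h1.trans (Finset.single_le_sum (f := fun j => |(m j : ℝ)|) (fun _ _ => abs_nonneg _)
      (Finset.mem_univ j))
  -- Comparing `σ α` with the real value `σ₀ α`, of size at most 1, eliminates `m₀`, so the bound
  -- depends on `m` alone.
  have hconj : ∀ σ : K →ₐ[ℚ] ℂ, ‖σ α‖ ≤ 3 * A * G := fun σ => by
    have h1 : σ α = σ₀ α + ∑ j, m j * (σ (ϑ j) - σ₀ (ϑ j)) := by
      simp only [α, map_add, map_sum, map_mul, map_intCast, mul_sub, Finset.sum_sub_distrib]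
      ring
    have h2 : ∀ (τ : K →ₐ[ℚ] ℂ) j, ‖τ (ϑ j)‖ ≤ G := fun τ j =>
      (norm_embedding_le (ϑ j) (hθ j) τ).trans (hG j)
    have h3 : ‖∑ j, (m j : ℂ) * (σ (ϑ j) - σ₀ (ϑ j))‖ ≤ A * (2 * G) := by
      rw [hA, Finset.sum_mul]
      refine norm_sum_le_of_le _ fun j _ => ?_
      rw [norm_mul, Complex.norm_intCast]
      gcongr
      calc _ ≤ _ := norm_sub_le _ _
        _ ≤ G + G := add_le_add (h2 _ _) (h2 _ _)
        _ = _ := by ring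
    have h4 : ‖σ₀ α‖ ≤ 1 := by
      rw [hσ₀, Complex.norm_real, hα]; exact hle
    calc ‖σ α‖ ≤ 1 + A * (2 * G) := h1 ▸ (norm_add_le _ _).trans (add_le_add h4 h3)
      _ ≤ A * G + A * (2 * G) := by gcongr; nlinarith
      _ = _ := by ring
  have hNle : (N : ℝ) ^ e ≤ ∏ j, weilHeight (θ j) ^ (e * algDegree (θ j)) := by
    simp only [N]
    push_cast
    rw [← Finset.prod_pow]
    refine Finset.prod_le_prod (fun j _ => by positivity) fun j _ => ?_
    rw [mul_comm, pow_mul]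
    exact pow_le_pow_left₀ (by positivity) (hnle j) _
  calc (1 : ℝ) ≤ ∏ σ : K →ₐ[ℚ] ℂ, ‖σ ((N : K) * α)‖ := hnorm
    _ = (N : ℝ) ^ e * (‖σ₀ α‖ * ∏ σ ∈ Finset.univ.erase σ₀, ‖σ α‖) := by
      rw [Finset.mul_prod_erase _ (fun σ : K →ₐ[ℚ] ℂ => ‖σ α‖) (Finset.mem_univ σ₀), ← hcard,
        ← Finset.card_univ, ← Finset.prod_const, ← Finset.prod_mul_distrib]
      simp
    _ ≤ (N : ℝ) ^ e * (‖σ₀ α‖ * (3 * A * G) ^ (e - 1)) := by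
      gcongr
      refine (Finset.prod_le_prod (fun _ _ => norm_nonneg _) fun σ _ => hconj σ).trans_eq ?_
      rw [Finset.prod_const, Finset.card_erase_of_mem (Finset.mem_univ _), Finset.card_univ, hcard]
    _ = (|(m₀ : ℝ) + ∑ j, m j * θ j| * (3 * A * G) ^ (e - 1)) * (N : ℝ) ^ e := by
      rw [hσ₀, Complex.norm_real, hα, Real.norm_eq_abs, mul_comm]
    _ ≤ _ := by gcongr

end Liouville

end EffectiveKronecker

end Heights

/-! ### From linear forms to inhomogeneous approximation -/

namespace EffectiveKronecker

lemma distInt_le {x : ℝ} (k : ℤ) {δ : ℝ} (h : |x - k| ≤ δ) : distInt x ≤ δ :=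
  (round_le x k).trans h

section Transference

variable {t : ℕ}

/-- If the linear form `m₀ + ∑ j, m j * θ j` is never small, then inhomogeneous simultaneous
approximation of `a` by `q * θ` is possible with `q` in any prescribed long interval. -/
theorem exists_distInt_le_of_linearForm (θ : Fin t → ℝ) {ε Q : ℝ} (hε : 0 < ε) (hQ : 0 < Q)
    (h : ∀ (m₀ : ℤ) (m : Fin t → ℤ), (m₀ ≠ 0 ∨ m ≠ 0) →
      (4 : ℝ) ^ t ≤ Q ^ 2 * ((m₀ : ℝ) + ∑ j, m j * θ j) ^ 2 + ε ^ 2 * ∑ j, (m j : ℝ) ^ 2)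
    (b : ℝ) (a : Fin t → ℝ) :
    ∃ q : ℤ, |(q : ℝ) - b| ≤ Q ∧ ∀ j, distInt ((q : ℝ) * θ j - a j) ≤ ε := by
  let f : (Fin (t + 1) → ℤ) →+ EuclideanSpace ℝ (Fin (t + 1)) := AddMonoidHom.mk'
    (fun m => WithLp.toLp 2 (Fin.cons (Q * ((m 0 : ℝ) + ∑ j : Fin t, m j.succ * θ j))
      (fun j => ε * m j.succ) : Fin (t + 1) → ℝ))
    (fun m m' => by
      ext i
      refine Fin.cases ?_ (fun j => ?_) i
      · simp [add_mul, Finset.sum_add_distrib]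
        ring
      · simp [mul_add])
  have hf0 : ∀ m, f m 0 = Q * ((m 0 : ℝ) + ∑ j : Fin t, m j.succ * θ j) := fun m => rfl
  have hfs : ∀ m j, f m (Fin.succ j) = ε * m j.succ := fun m j => rfl
  have hfn : ∀ m, ‖f m‖ ^ 2 = Q ^ 2 * ((m 0 : ℝ) + ∑ j : Fin t, m j.succ * θ j) ^ 2 +
      ε ^ 2 * ∑ j : Fin t, (m j.succ : ℝ) ^ 2 := fun m => by
    rw [EuclideanSpace.norm_sq_eq, Fin.sum_univ_succ, hf0, Finset.mul_sum]
    simp [hfs, mul_pow]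
  have hlow : ∀ m, m ≠ 0 → (4 : ℝ) ^ t ≤ ‖f m‖ ^ 2 := fun m hm => by
    rw [hfn]
    refine h (m 0) (fun j => m j.succ) ?_
    by_contra hcon
    push Not at hcon
    refine hm (funext fun i => Fin.cases hcon.1 (fun j => congrFun hcon.2 j) i)
  -- The term `-b` centres `q` at `b`; the term `-b * θ j` turns `Q y₀ θ_j` into `q θ_j` up to
  -- integers.
  let φ₀ : (Fin (t + 1) → ℤ) →+ ℝ := AddMonoidHom.mk'
    (fun m => m 0 * (-b) + ∑ j : Fin t, m j.succ * (a j - b * θ j))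
    (fun m m' => by
      simp only [Pi.add_apply, Int.cast_add, add_mul, Finset.sum_add_distrib]
      ring)
  have hφ₀ : ∀ m, φ₀ m = m 0 * (-b) + ∑ j : Fin t, m j.succ * (a j - b * θ j) := fun m => rfl
  let φ : (Fin (t + 1) → ℤ) →+ UnitAddCircle :=
    (QuotientAddGroup.mk' (AddSubgroup.zmultiples (1 : ℝ))).comp φ₀
  have hφ : ∀ m, φ m = ((φ₀ m : ℝ) : UnitAddCircle) := fun m => rfl
  have h4 : (0 : ℝ) < 4 ^ t := by positivity
  obtain ⟨y, -, hy, hyφ⟩ := exists_inner_eq_character (t + 1) ⊤ (by simp) f (fun _ => trivial) φ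
    (fun m hm => by
      by_cases hm0 : m = 0
      · rw [hm0, map_zero]
      · have := hlow m hm0
        rw [hm, norm_zero] at this
        linarith) h4
    (fun m hm => hlow m fun h0 => hm (by rw [h0, map_zero]))
  have hy1 : ‖y‖ ≤ 1 := by
    rw [pow_succ (4 : ℝ) t, mul_div_cancel_right₀ _ (by norm_num : (4 : ℝ) ≠ 0)] at hy
    have : ‖y‖ ^ 2 ≤ 1 := by nlinarith
    exact (sq_le_one_iff₀ (norm_nonneg _)).1 this
  have hyi : ∀ i, |y i| ≤ 1 := fun i => (PiLp.norm_apply_le y i).trans hy1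
  have hinner : ∀ m, ⟪y, f m⟫_ℝ = y 0 * (Q * ((m 0 : ℝ) + ∑ j : Fin t, m j.succ * θ j)) +
      ∑ j : Fin t, y j.succ * (ε * m j.succ) := fun m => by
    rw [PiLp.inner_apply, Fin.sum_univ_succ]
    simp [hf0, hfs, mul_comm]
  have key : ∀ m, ∃ k : ℤ, ⟪y, f m⟫_ℝ - φ₀ m = k := fun m =>
    (UnitAddCircle.coe_eq_coe_iff _ _).1 ((hyφ m).trans (hφ m))
  obtain ⟨q, hq⟩ := key (Pi.single 0 1)
  rw [hinner, hφ₀] at hq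
  simp at hq
  refine ⟨q, ?_, fun j => ?_⟩
  · rw [← hq]
    have : y 0 * Q + b - b = y 0 * Q := by ring
    rw [this, abs_mul, abs_of_pos hQ]
    exact mul_le_of_le_one_left hQ.le (hyi 0)
  · obtain ⟨k, hk⟩ := key (Pi.single j.succ 1)
    rw [hinner, hφ₀] at hk
    simp [Pi.single_apply] at hk
    refine distInt_le k ?_
    have : (q : ℝ) * θ j - a j - k = - (y j.succ * ε) := by
      rw [← hk, ← hq]; ring
    rw [this, abs_neg, abs_mul, abs_of_pos hε]
    exact mul_le_of_le_one_left hε.le (hyi _)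

end Transference

section LinearIndependence

variable {t : ℕ} {θ : Fin t → ℝ}

lemma eq_zero_of_linearForm_eq_zero
    (hlin : LinearIndependent ℚ (Fin.cons 1 θ : Fin (t + 1) → ℝ)) {m₀ : ℤ} {m : Fin t → ℤ}
    (h : (m₀ : ℝ) + ∑ j, m j * θ j = 0) : m₀ = 0 ∧ m = 0 := by
  have := Fintype.linearIndependent_iff.1 hlin (Fin.cons (m₀ : ℚ) fun j => (m j : ℚ)) (by
    rw [Fin.sum_univ_succ]
    simpa [Rat.smul_def] using h)
  refine ⟨by simpa using this 0, funext fun j => by simpa using this j.succ⟩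

lemma ratCast_ne_of_linearIndependent
    (hlin : LinearIndependent ℚ (Fin.cons 1 θ : Fin (t + 1) → ℝ)) (j : Fin t) (r : ℚ) :
    (r : ℝ) ≠ θ j := by
  intro hr
  have h : ((-r.num : ℤ) : ℝ) + ∑ i, ((Pi.single j (r.den : ℤ) : Fin t → ℤ) i : ℝ) * θ i = 0 := by
    rw [Finset.sum_eq_single j (fun i _ hi => by simp [hi]) (by simp), ← hr]
    have h1 : (r.den : ℝ) * (r : ℝ) = r.num := by exact_mod_cast Rat.den_mul_eq_num r
    simp [h1]
  have := congrFun (eq_zero_of_linearForm_eq_zero hlin h).2 j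
  simp at this

end LinearIndependence

/-- If `|α| ≥ 1` or `ε ^ 2 * S ≥ 4 ^ t`, one summand suffices. Otherwise `m ≠ 0` has size controlled
by `1 / ε`, and Liouville gives `Q * |α| ≥ 2 ^ t`; the base of the power in `Q` is the resulting
bound for `3 * A * G`. -/
lemma pow_le_linearForm_sq {t : ℕ} {θ : Fin t → ℝ} (hθ : ∀ j, IsAlgebraic ℚ (θ j))
    (hlin : LinearIndependent ℚ (Fin.cons 1 θ : Fin (t + 1) → ℝ)) {ε G Q : ℝ} (hε : 0 < ε)
    (hε1 : ε ≤ 1) (hG1 : 1 ≤ G) (hG : ∀ j, weilHeight (θ j) ^ algDegree (θ j) ≤ G)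
    (hQ : Q = 2 ^ t * (2 ^ t * (3 / 2 * (t + 1) * G / ε)) ^ (fieldDegree θ - 1) *
      ∏ j, weilHeight (θ j) ^ (fieldDegree θ * algDegree (θ j)))
    (m₀ : ℤ) (m : Fin t → ℤ) (hm : m₀ ≠ 0 ∨ m ≠ 0) :
    (4 : ℝ) ^ t ≤ Q ^ 2 * ((m₀ : ℝ) + ∑ j, m j * θ j) ^ 2 + ε ^ 2 * ∑ j, (m j : ℝ) ^ 2 := by
  have hP : 1 ≤ ∏ j, weilHeight (θ j) ^ (fieldDegree θ * algDegree (θ j)) :=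
    Finset.one_le_prod fun j _ => one_le_pow₀ (one_le_weilHeight (hθ j))
  have h2t : (1 : ℝ) ≤ 2 ^ t := one_le_pow₀ (by norm_num)
  have hB : 1 ≤ (2 : ℝ) ^ t * (3 / 2 * (t + 1) * G / ε) := by
    refine one_le_mul_of_one_le_of_one_le h2t ((one_le_div hε).2 ?_)
    have : (0 : ℝ) ≤ t := Nat.cast_nonneg t
    nlinarith
  have h4 : (4 : ℝ) ^ t = (2 ^ t) ^ 2 := by rw [← pow_mul, mul_comm, pow_mul]; norm_num
  set α := (m₀ : ℝ) + ∑ j, m j * θ j with hα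
  have hα0 : α ≠ 0 := fun h => by
    have := eq_zero_of_linearForm_eq_zero hlin h
    tauto
  set S := ∑ j, (m j : ℝ) ^ 2 with hS
  have hS0 : 0 ≤ S := Finset.sum_nonneg fun _ _ => sq_nonneg _
  have hQ2 : 2 ^ t ≤ Q := by
    rw [hQ, mul_assoc]
    exact le_mul_of_one_le_right (by positivity)
      (one_le_mul_of_one_le_of_one_le (one_le_pow₀ hB) hP)
  have suff : 2 ^ t ≤ Q * |α| → (4 : ℝ) ^ t ≤ Q ^ 2 * α ^ 2 + ε ^ 2 * S := fun h => by
    rw [h4, ← sq_abs α, ← mul_pow]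
    have := pow_le_pow_left₀ (by positivity) h 2
    nlinarith [sq_nonneg ε]
  rcases le_or_gt 1 |α| with h1 | h1
  · exact suff (hQ2.trans (le_mul_of_one_le_right (by linarith) h1))
  have hm0 : m ≠ 0 := by
    rintro rfl
    have h0 : m₀ ≠ 0 := by tauto
    have : (1 : ℝ) ≤ |(m₀ : ℝ)| := by exact_mod_cast Int.one_le_abs h0
    simp [hα] at h1
    linarith
  rcases le_or_gt (4 ^ t) (ε ^ 2 * S) with h3 | h3
  · nlinarith [mul_nonneg (sq_nonneg Q) (sq_nonneg α)]
  refine suff ?_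
  have hL := one_le_abs_linearForm_mul hθ m₀ m hm0 hG hG1 hα0 h1.le
  rw [← hα] at hL
  set A := ∑ j, |(m j : ℝ)| with hA
  have hA0 : 0 ≤ A := Finset.sum_nonneg fun _ _ => abs_nonneg _
  have hAS : A ^ 2 ≤ t * S := by
    simpa using sq_sum_le_card_mul_sum_sq (s := Finset.univ) (f := fun j => |(m j : ℝ)|)
  -- Cauchy–Schwarz gives `√t`, which is replaced by `(t + 1) / 2`.
  have hεA : ε * A ≤ 2 ^ t * ((t + 1) / 2) := by
    refine le_of_sq_le_sq ?_ (by positivity)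
    have ht : (t : ℝ) ≤ ((t + 1) / 2) ^ 2 := by nlinarith [sq_nonneg ((t : ℝ) - 1)]
    calc (ε * A) ^ 2 = ε ^ 2 * A ^ 2 := mul_pow _ _ _
      _ ≤ ε ^ 2 * (t * S) := by gcongr
      _ = (ε ^ 2 * S) * t := by ring
      _ ≤ 4 ^ t * ((t + 1) / 2) ^ 2 := by gcongr
      _ = _ := by rw [h4, mul_pow]
  have h3AG : 3 * A * G ≤ 2 ^ t * (3 / 2 * (t + 1) * G / ε) := by
    rw [← mul_div_assoc, le_div_iff₀ hε]
    nlinarith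
  have hP0 : 0 ≤ ∏ j, weilHeight (θ j) ^ (fieldDegree θ * algDegree (θ j)) := by linarith
  have hL' : 1 ≤ |α| * (2 ^ t * (3 / 2 * (t + 1) * G / ε)) ^ (fieldDegree θ - 1) *
      ∏ j, weilHeight (θ j) ^ (fieldDegree θ * algDegree (θ j)) := hL.trans (by gcongr)
  calc (2 : ℝ) ^ t ≤ 2 ^ t * (|α| * (2 ^ t * (3 / 2 * (t + 1) * G / ε)) ^ (fieldDegree θ - 1) *
        ∏ j, weilHeight (θ j) ^ (fieldDegree θ * algDegree (θ j))) :=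
      le_mul_of_one_le_right (by positivity) hL'
    _ = Q * |α| := by rw [hQ]; ring

end EffectiveKronecker

/-! ### Comparison of the constants -/

namespace EffectiveKronecker

lemma fieldDegree_pos {t : ℕ} {θ : Fin t → ℝ} (hθ : ∀ j, IsAlgebraic ℚ (θ j)) :
    0 < fieldDegree θ := by
  have : FiniteDimensional ℚ (IntermediateField.adjoin ℚ (Set.range θ)) := by
    apply IntermediateField.finiteDimensional_adjoin
    rintro _ ⟨j, rfl⟩
    exact (hθ j).isIntegral
  exact Module.finrank_pos

/-- Here `k + 1` is the field degree `e`. Irrationality gives `d j ≥ 2`, so the factors 2 in `C₁`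
supply `2 ^ (2 * e * t)`, enough for both `2 ^ (-e * t)` and the powers of 2 in `Q`. The rest, `3 *
(3 / 2) ^ k ≤ 4 ^ e`, is absorbed by the factorial. -/
lemma three_mul_le_of_two_le {t k : ℕ} (ht : 1 ≤ t) {G ε : ℝ} (hε : 0 < ε) (hG : 1 ≤ G)
    (h : Fin t → ℝ) (hh : ∀ j, 1 ≤ h j) (d : Fin t → ℕ) (hd : ∀ j, 2 ≤ d j) :
    3 * (2 ^ t * (2 ^ t * (3 / 2 * (t + 1) * G / ε)) ^ k * ∏ j, h j ^ ((k + 1) * d j)) ≤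
      (2 : ℝ) ^ (-(((k + 1 : ℕ) : ℤ) * (t : ℤ))) * ((t + 1).factorial : ℝ) ^ (2 * (k + 1)) *
        ((((t : ℝ) + 1) * G) ^ k * ∏ j, (2 * h j) ^ ((k + 1) * d j)) *
        ε ^ (-((k + 1 : ℕ) : ℤ) + 1) := by
  have hP : 0 < ∏ j, h j ^ ((k + 1) * d j) :=
    Finset.prod_pos fun j _ => pow_pos (zero_lt_one.trans_le (hh j)) _
  have h2 : (2 : ℝ) ^ ((k + 1) * t) * 2 ^ ((k + 1) * t) ≤ ∏ j, (2 : ℝ) ^ ((k + 1) * d j) := by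
    rw [Finset.prod_pow_eq_pow_sum, ← pow_add]
    refine pow_le_pow_right₀ (by norm_num) ?_
    rw [← Finset.mul_sum, ← mul_add]
    have : ∑ _j : Fin t, 2 ≤ ∑ j, d j := Finset.sum_le_sum fun j _ => hd j
    simp only [Finset.sum_const, Finset.card_univ, Fintype.card_fin, smul_eq_mul] at this
    exact Nat.mul_le_mul_left _ (by omega)
  have hz : (2 : ℝ) ^ (-(((k + 1 : ℕ) : ℤ) * (t : ℤ))) = (2 ^ ((k + 1) * t))⁻¹ := by
    rw [zpow_neg, ← Nat.cast_mul, zpow_natCast]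
  have hεz : ε ^ (-((k + 1 : ℕ) : ℤ) + 1) = (ε ^ k)⁻¹ := by
    rw [← zpow_natCast, ← zpow_neg]
    congr 1
    push_cast
    ring
  have hfac : (3 : ℝ) * (3 / 2) ^ k ≤ ((t + 1).factorial : ℝ) ^ (2 * (k + 1)) := by
    have h1 : (2 : ℝ) ≤ (t + 1).factorial := by
      exact_mod_cast (show 2 ≤ t + 1 by omega).trans (Nat.self_le_factorial _)
    calc (3 : ℝ) * (3 / 2) ^ k ≤ 4 * 4 ^ k := by gcongr <;> norm_num
      _ = 2 ^ (2 * (k + 1)) := by rw [pow_mul, pow_succ]; norm_num; ring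
      _ ≤ _ := by gcongr
  rw [hz, hεz]
  simp only [mul_pow, Finset.prod_mul_distrib, div_pow]
  set P := ∏ j, h j ^ ((k + 1) * d j)
  set D := ∏ j, (2 : ℝ) ^ ((k + 1) * d j)
  set F := ((t + 1).factorial : ℝ) ^ (2 * (k + 1))
  have h3 : (2 : ℝ) ^ ((k + 1) * t) ≤ (2 ^ ((k + 1) * t))⁻¹ * D := by
    rw [inv_mul_eq_div, le_div_iff₀ (by positivity)]
    exact h2
  have h4 : (2 : ℝ) ^ t * (2 ^ t) ^ k = 2 ^ ((k + 1) * t) := by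
    rw [← pow_succ', ← pow_mul, mul_comm]
  have hnn : 0 ≤ (((t : ℝ) + 1) ^ k * G ^ k) * (ε ^ k)⁻¹ * P := by positivity
  calc _ = (2 ^ t * (2 ^ t) ^ k) * (3 * (3 / 2) ^ k) *
        ((((t : ℝ) + 1) ^ k * G ^ k) * (ε ^ k)⁻¹ * P) := by
        rw [div_pow]; ring
    _ ≤ ((2 ^ ((k + 1) * t))⁻¹ * D) * F * ((((t : ℝ) + 1) ^ k * G ^ k) * (ε ^ k)⁻¹ * P) := by
        rw [h4]; gcongr
    _ = _ := by ring

/-- The powers of 2, the factorials, the heights and `ε` are compared separately, with `e = k + 1`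
and `ℓ = l + 1`. -/
lemma bound_le_of_height_le {t k l : ℕ} {G ε H : ℝ} (hε : 0 < ε) (hε1 : ε ≤ 1) (hG0 : 0 ≤ G)
    (hG : G ≤ H ^ (l + 1)) (hH : 1 ≤ H) (h : Fin t → ℝ) (hh : ∀ j, 1 ≤ h j) (hhH : ∀ j, h j ≤ H)
    (d : Fin t → ℕ) (hd : ∀ j, d j ≤ l + 1) (hkl : k ≤ l) :
    (2 : ℝ) ^ (-(((k + 1 : ℕ) : ℤ) * (t : ℤ))) * ((t + 1).factorial : ℝ) ^ (2 * (k + 1)) *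
        ((((t : ℝ) + 1) * G) ^ k * ∏ j, (2 * h j) ^ ((k + 1) * d j)) *
        ε ^ (-((k + 1 : ℕ) : ℤ) + 1) ≤
      (2 : ℝ) ^ (((l + 1 : ℕ) : ℤ) * (t : ℤ) * (((l + 1 : ℕ) : ℤ) - 1)) *
        ((t : ℝ) + 1) ^ (3 * ((l + 1 : ℕ) : ℤ) - 1) * (t.factorial : ℝ) ^ (2 * (l + 1)) *
        H ^ (((l + 1 : ℕ) : ℤ) ^ 2 * ((t : ℤ) + 1) - ((l + 1 : ℕ) : ℤ)) *
        ε ^ (-((l + 1 : ℕ) : ℤ) + 1) := by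
  have h2 : (2 : ℝ) ^ (-(((k + 1 : ℕ) : ℤ) * (t : ℤ))) * ∏ j, (2 : ℝ) ^ ((k + 1) * d j) ≤
      (2 : ℝ) ^ (((l + 1 : ℕ) : ℤ) * (t : ℤ) * (((l + 1 : ℕ) : ℤ) - 1)) := by
    rw [Finset.prod_pow_eq_pow_sum, ← zpow_natCast, ← zpow_add₀ (by norm_num)]
    refine zpow_le_zpow_right₀ (by norm_num) ?_
    have h1 : ∑ j, (k + 1) * d j ≤ (k + 1) * (t * (l + 1)) := by
      rw [← Finset.mul_sum]
      gcongr
      refine (Finset.sum_le_sum fun j _ => hd j).trans_eq ?_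
      simp
    have h3 : ((∑ j, (k + 1) * d j : ℕ) : ℤ) ≤ (k + 1) * (t * (l + 1)) := by exact_mod_cast h1
    have h4 : ((k : ℤ) + 1) * (t * l) ≤ (l + 1) * (t * l) := by gcongr
    push_cast at h3 ⊢
    linarith
  have hf : ((t + 1).factorial : ℝ) ^ (2 * (k + 1)) * ((t : ℝ) + 1) ^ k ≤
      ((t : ℝ) + 1) ^ (3 * ((l + 1 : ℕ) : ℤ) - 1) * (t.factorial : ℝ) ^ (2 * (l + 1)) := by
    have h1 : (1 : ℝ) ≤ t.factorial := by exact_mod_cast t.factorial_pos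
    have h3 : (3 * ((l + 1 : ℕ) : ℤ) - 1) = ((2 * (l + 1) + l : ℕ) : ℤ) := by push_cast; ring
    have ht : (1 : ℝ) ≤ t + 1 := by linarith [(Nat.cast_nonneg t : (0 : ℝ) ≤ t)]
    rw [h3, zpow_natCast, Nat.factorial_succ]
    push_cast
    rw [mul_pow, mul_right_comm, ← pow_add]
    exact mul_le_mul (pow_le_pow_right₀ ht (by omega)) (pow_le_pow_right₀ h1 (by omega))
      (by positivity) (by positivity)
  have hHe : G ^ k * ∏ j, h j ^ ((k + 1) * d j) ≤
      H ^ (((l + 1 : ℕ) : ℤ) ^ 2 * ((t : ℤ) + 1) - ((l + 1 : ℕ) : ℤ)) := by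
    have h1 : ∏ j, h j ^ ((k + 1) * d j) ≤ (H ^ ((l + 1) * (l + 1))) ^ t := by
      refine (Finset.prod_le_prod (g := fun _ => H ^ ((l + 1) * (l + 1)))
        (fun j _ => pow_nonneg (zero_le_one.trans (hh j)) _) fun j _ => ?_).trans_eq (by simp)
      refine (pow_le_pow_left₀ (zero_le_one.trans (hh j)) (hhH j) _).trans
        (pow_le_pow_right₀ hH (Nat.mul_le_mul (by omega) (hd j)))
    have h3 : G ^ k ≤ (H ^ (l + 1)) ^ l :=
      (pow_le_pow_left₀ hG0 hG k).trans (pow_le_pow_right₀ (one_le_pow₀ hH) hkl)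
    have h4 : ((l + 1 : ℕ) : ℤ) ^ 2 * ((t : ℤ) + 1) - ((l + 1 : ℕ) : ℤ) =
        (((l + 1) * l + (l + 1) * (l + 1) * t : ℕ) : ℤ) := by push_cast; ring
    rw [h4, zpow_natCast, pow_add, pow_mul, pow_mul H ((l + 1) * (l + 1))]
    exact mul_le_mul h3 h1 (Finset.prod_nonneg fun j _ => pow_nonneg (zero_le_one.trans (hh j)) _)
      (by positivity)
  have hεe : ε ^ (-((k + 1 : ℕ) : ℤ) + 1) ≤ ε ^ (-((l + 1 : ℕ) : ℤ) + 1) :=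
    zpow_le_zpow_right_of_le_one₀ hε hε1 (by push_cast; omega)
  have hhnn : 0 ≤ ∏ j, h j ^ ((k + 1) * d j) :=
    Finset.prod_nonneg fun j _ => pow_nonneg (zero_le_one.trans (hh j)) _
  have hH0 : 0 < H := by linarith
  simp only [mul_pow, Finset.prod_mul_distrib]
  calc _ = ((2 : ℝ) ^ (-(((k + 1 : ℕ) : ℤ) * (t : ℤ))) * ∏ j, (2 : ℝ) ^ ((k + 1) * d j)) *
        (((t + 1).factorial : ℝ) ^ (2 * (k + 1)) * ((t : ℝ) + 1) ^ k) *
        (G ^ k * ∏ j, h j ^ ((k + 1) * d j)) * ε ^ (-((k + 1 : ℕ) : ℤ) + 1) := by ring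
    _ ≤ _ * (_ * _) * _ * _ :=
        mul_le_mul (mul_le_mul (mul_le_mul h2 hf (by positivity) (by positivity)) hHe
          (by positivity) (by positivity)) hεe (by positivity) (by positivity)
    _ = _ := by ring

end EffectiveKronecker

theorem theorem3 (t : ℕ) (ht : 1 ≤ t) (θ : Fin t → ℝ)
    (hθ : ∀ j, IsAlgebraic ℚ (θ j))
    (hlin : LinearIndependent ℚ (Fin.cons 1 θ : Fin (t + 1) → ℝ))
    (ε : ℝ) (hε : 0 < ε) (hε1 : ε ≤ 1) (a : Fin t → ℝ) :
    ∃ q : ℤ, q ≠ 0 ∧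
      (∀ j, EffectiveKronecker.distInt ((q : ℝ) * θ j - a j) ≤ ε) ∧
      |(q : ℝ)| ≤
        (2 : ℝ) ^ (-((EffectiveKronecker.fieldDegree θ : ℤ) * (t : ℤ))) *
          ((t + 1).factorial : ℝ) ^ (2 * EffectiveKronecker.fieldDegree θ) *
          EffectiveKronecker.C₁ θ *
          ε ^ (-(EffectiveKronecker.fieldDegree θ : ℤ) + 1) ∧
      ∀ (H : ℝ) (ℓ : ℕ),
        (∀ j, EffectiveKronecker.weilHeight (θ j) ≤ H) →
        EffectiveKronecker.fieldDegree θ ≤ ℓ →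
        (∀ j, EffectiveKronecker.algDegree (θ j) ≤ ℓ) →
        |(q : ℝ)| ≤
          (2 : ℝ) ^ ((ℓ : ℤ) * (t : ℤ) * ((ℓ : ℤ) - 1)) *
            ((t : ℝ) + 1) ^ (3 * (ℓ : ℤ) - 1) *
            (t.factorial : ℝ) ^ (2 * ℓ) *
            H ^ ((ℓ : ℤ) ^ 2 * ((t : ℤ) + 1) - (ℓ : ℤ)) *
            ε ^ (-(ℓ : ℤ) + 1) := by
  have : Nonempty (Fin t) := ⟨⟨0, ht⟩⟩
  have hbdd : BddAbove (Set.range fun j => EffectiveKronecker.weilHeight (θ j) ^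
      EffectiveKronecker.algDegree (θ j)) := (Set.finite_range _).bddAbove
  set G := ⨆ j, EffectiveKronecker.weilHeight (θ j) ^ EffectiveKronecker.algDegree (θ j) with hGdef
  have hG : ∀ j, EffectiveKronecker.weilHeight (θ j) ^ EffectiveKronecker.algDegree (θ j) ≤ G :=
    fun j => le_ciSup hbdd j
  have hh := fun j => EffectiveKronecker.one_le_weilHeight (hθ j)
  have hG1 : 1 ≤ G := (one_le_pow₀ (hh ⟨0, ht⟩)).trans (hG ⟨0, ht⟩)
  set Q : ℝ := 2 ^ t * (2 ^ t * (3 / 2 * (t + 1) * G / ε)) ^ (EffectiveKronecker.fieldDegree θ - 1) *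
    ∏ j, EffectiveKronecker.weilHeight (θ j) ^
      (EffectiveKronecker.fieldDegree θ * EffectiveKronecker.algDegree (θ j)) with hQ
  have hQ0 : 0 < Q := by
    have hP : 0 < ∏ j, EffectiveKronecker.weilHeight (θ j) ^
        (EffectiveKronecker.fieldDegree θ * EffectiveKronecker.algDegree (θ j)) :=
      Finset.prod_pos fun j _ => pow_pos (zero_lt_one.trans_le (hh j)) _
    have : 0 < G := by linarith
    positivity
  -- The centre `2 * Q` keeps the interval of radius `Q` away from 0, at the cost of the factor 3.
  obtain ⟨q, hq, hqθ⟩ := EffectiveKronecker.exists_distInt_le_of_linearForm θ hε hQ0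
    (EffectiveKronecker.pow_le_linearForm_sq hθ hlin hε hε1 hG1 hG hQ) (2 * Q) a
  obtain ⟨hq1, hq2⟩ := abs_le.1 hq
  have hqpos : (0 : ℝ) < q := by linarith
  have hd := fun j => EffectiveKronecker.two_le_algDegree (hθ j)
    (EffectiveKronecker.ratCast_ne_of_linearIndependent hlin j)
  obtain ⟨k, hk⟩ := Nat.exists_eq_add_of_le' (EffectiveKronecker.fieldDegree_pos hθ)
  have hqQ : |(q : ℝ)| ≤ 3 * Q := by rw [abs_of_pos hqpos]; linarith
  have hbound := EffectiveKronecker.three_mul_le_of_two_le (k := k) ht hε hG1 _ hh _ hd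
  rw [EffectiveKronecker.C₁, ← hGdef]
  rw [hk, Nat.add_sub_cancel] at hQ ⊢
  rw [← hQ] at hbound
  refine ⟨q, by exact_mod_cast hqpos.ne', hqθ, hqQ.trans hbound, fun H ℓ hH hℓ hdℓ => ?_⟩
  obtain ⟨l, rfl⟩ := Nat.exists_eq_add_of_le' (show 1 ≤ ℓ by omega)
  have hH1 : 1 ≤ H := (hh ⟨0, ht⟩).trans (hH ⟨0, ht⟩)
  refine (hqQ.trans hbound).trans (EffectiveKronecker.bound_le_of_height_le hε hε1
    (zero_le_one.trans hG1) (ciSup_le fun j => ?_) hH1 _ hh hH _ hdℓ (by omega))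
  exact (pow_le_pow_left₀ (zero_le_one.trans (hh j)) (hH j) _).trans
    (pow_le_pow_right₀ hH1 (hdℓ j))
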